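/- Let $\mathbb{F}$ be an arbitrary (possibly finite) field and $n\ge 1$ an integer. For $m\ge1$ let $M_n^m$ be the space of $m$-tuples $\underline{A}=(A_1,\dots,A_m)$ of $n\times n$ matrices over $\mathbb{F}$, on which $\mathrm{GL}_n=\mathrm{GL}_n(\mathbb{F})$ acts by $g\cdot\underline{A}=(gA_1g^{-1},\dots,gA_mg^{-1})$. Let $D_n\subset M_n^2$ be the set of pairs $(A_1,A_2)$ such that $A_1$ has $n$ distinct eigenvalues in $\mathbb{F}$. Let $X_k=(x_{ij}(k))_{1\le i,j\le n}$, $1\le k\le m$, be the generic matrices, whose entries are independent commuting variables, and let $\mathcal{X}_m$ be the unital associative $\mathbb{F}$-algebra generated by $X_1,\dots,X_m$ inside the $n\times n$ matrices over $\mathbb{F}[x_{ij}(k)]$. For $F\in\mathcal{X}_m$ and $\underline{A}\in M_n^m$ let $F(\underline{A})\in M_n$ be the result of substituting the entries of $\underline{A}$ for the variables, and let $\deg F$ be the minimal degree of a non-commutative polynomial $f$ (possibly with a constant term) in $m$ letters such that $F=f(X_1,\dots,X_m)$. An abstract invariant of $m$-tuples is a function $f:M_n^m\to\mathbb{F}$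 with $f(g\cdot\underline{A})=f(\underline{A})$ for all $g\in\mathrm{GL}_n$ and $\underline{A}\in M_n^m$. Its width is the least $d>0$ such that $f(\underline{A})=h(F_1(\underline{A}),\dots,F_d(\underline{A}))$ for all $\underline{A}$, for some abstract invariant $h$ of $d$-tuples and some $F_1,\dots,F_d\in\mathcal{X}_m$. For $0\le t\le n$ and $F\in\mathcal{X}_m$ let $\mathrm{rank}_t(F):M_n^m\to\mathbb{F}$ be the function equal to $1$ at $\underline{A}$ if $\mathrm{rank}\,F(\underline{A})=t$, and to $0$ otherwise. Then the functions $$\mathrm{rank}_t(F),\qquad 0\le t\le n,\quad F\in\mathcal{X}_2 \text{ with } \deg F\le (n+1)(2n-1),$$ are abstract invariants of width one, and they separate the $\mathrm{GL}_n$-orbits on $D_n$: if $\underline{A},\underline{B}\in D_n$ satisfy $\mathrm{rank}_t(F)(\underline{A})=\mathrm{rank}_t(F)(\underline{B})$ for all these $t$ and $F$, then $\mathrm{GL}_n\cdot\underline{A}=\mathrm{GL}_n\cdot\underline{B}$. -/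

import Mathlib

open scoped MatrixGroups

noncomputable section

namespace MatrixOrbits

/-- The space of `m`-tuples of `n × n` matrices over `𝔽`. -/
abbrev MatTuple (𝔽 : Type*) (n m : ℕ) : Type _ := Fin m → Matrix (Fin n) (Fin n) 𝔽

/-- The action of `GL_n` by simultaneous conjugation,
`g · (A_1, …, A_m) = (g A_1 g⁻¹, …, g A_m g⁻¹)`. -/
def simConj {𝔽 : Type*} [Field 𝔽] {n m : ℕ} (g : GL (Fin n) 𝔽) (A : MatTuple 𝔽 n m) :
    MatTuple 𝔽 n m :=
  fun k => (g : Matrix (Fin n) (Fin n) 𝔽) * A k * ((g⁻¹ : GL (Fin n) 𝔽) : Matrix (Fin n) (Fin n) 𝔽)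

/-- The `GL_n`-orbit of a tuple of matrices. -/
def glOrbit {𝔽 : Type*} [Field 𝔽] {n m : ℕ} (A : MatTuple 𝔽 n m) : Set (MatTuple 𝔽 n m) :=
  Set.range fun g : GL (Fin n) 𝔽 => simConj g A

/-- The pairs `(A_1, A_2)` such that `A_1` has `n` distinct eigenvalues in `𝔽`. -/
def simpleSpectrumPairs (𝔽 : Type*) [Field 𝔽] (n : ℕ) : Set (MatTuple 𝔽 n 2) :=
  {A | (spectrum 𝔽 (A 0)).encard = n}

/-- The coordinate algebra `𝔽[x_{ij}(k)]` of the space of `m`-tuples of `n × n` matrices;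
the variable `x_{ij}(k)` is indexed by `(k, i, j)`. -/
abbrev CoordRing (𝔽 : Type*) [Field 𝔽] (n m : ℕ) : Type _ :=
  MvPolynomial (Fin m × Fin n × Fin n) 𝔽

/-- The generic matrix `X_k = (x_{ij}(k))`. -/
def genericMatrix (𝔽 : Type*) [Field 𝔽] (n m : ℕ) (k : Fin m) :
    Matrix (Fin n) (Fin n) (CoordRing 𝔽 n m) :=
  Matrix.of fun i j => MvPolynomial.X (k, i, j)

/-- The unital associative `𝔽`-algebra generated by the generic matrices `X_1, …, X_m`. -/
def genericAlgebra (𝔽 : Type*) [Field 𝔽] (n m : ℕ) :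
    Subalgebra 𝔽 (Matrix (Fin n) (Fin n) (CoordRing 𝔽 n m)) :=
  Algebra.adjoin 𝔽 (Set.range (genericMatrix 𝔽 n m))

/-- The value `F(A)` of a matrix `F` of polynomials at a tuple `A`. -/
def evalAt {𝔽 : Type*} [Field 𝔽] {n m : ℕ} (F : Matrix (Fin n) (Fin n) (CoordRing 𝔽 n m))
    (A : MatTuple 𝔽 n m) : Matrix (Fin n) (Fin n) 𝔽 :=
  F.map (MvPolynomial.eval fun v => A v.1 v.2.1 v.2.2)

/-- The degree of a non-commutative polynomial in `m` letters: the largest length of a word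
that occurs in it with non-zero coefficient (and `0` for the zero polynomial). -/
def ncDegree {𝔽 : Type*} [Field 𝔽] {m : ℕ} (f : FreeAlgebra 𝔽 (Fin m)) : ℕ :=
  (FreeAlgebra.equivMonoidAlgebraFreeMonoid f : MonoidAlgebra 𝔽 (FreeMonoid (Fin m))).coeff.support.sup
    fun w => w.length

/-- The degree of an element `F` of the algebra of generic matrices: the least degree of a
non-commutative polynomial `f` such that `F = f(X_1, …, X_m)`. -/
def genericDegree {𝔽 : Type*} [Field 𝔽] {n m : ℕ} (F : genericAlgebra 𝔽 n m) : ℕ :=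
  sInf {d | ∃ f : FreeAlgebra 𝔽 (Fin m),
    FreeAlgebra.lift 𝔽 (genericMatrix 𝔽 n m) f = F ∧ ncDegree f = d}

/-- The algebra of abstract matrix invariants: all functions on `m`-tuples of matrices with
values in `𝔽` that are constant on `GL_n`-orbits, with pointwise operations. -/
def abstractInvariants (𝔽 : Type*) [Field 𝔽] (n m : ℕ) : Subalgebra 𝔽 (MatTuple 𝔽 n m → 𝔽) where
  carrier := {f | ∀ (g : GL (Fin n) 𝔽) (A : MatTuple 𝔽 n m), f (simConj g A) = f A}
  mul_mem' ha hb g A := by simp only [Pi.mul_apply, ha g A, hb g A]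
  add_mem' ha hb g A := by simp only [Pi.add_apply, ha g A, hb g A]
  algebraMap_mem' _ _ _ := rfl

/-- The composition `h(F_1, …, F_d)`. -/
def compGeneric {𝔽 : Type*} [Field 𝔽] {n m d : ℕ} (h : MatTuple 𝔽 n d → 𝔽)
    (F : Fin d → genericAlgebra 𝔽 n m) : MatTuple 𝔽 n m → 𝔽 :=
  fun A => h fun k => evalAt (F k : Matrix (Fin n) (Fin n) (CoordRing 𝔽 n m)) A

/-- The width of `f`: the least `d > 0` such that `f = h(F_1, …, F_d)` for some abstract
invariant `h` of `d`-tuples and elements `F_1, …, F_d` of the algebra of generic matrices. -/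
def width {𝔽 : Type*} [Field 𝔽] {n m : ℕ} (f : abstractInvariants 𝔽 n m) : ℕ :=
  sInf {d | 0 < d ∧ ∃ h ∈ abstractInvariants 𝔽 n d, ∃ F : Fin d → genericAlgebra 𝔽 n m,
    (f : MatTuple 𝔽 n m → 𝔽) = compGeneric h F}

/-- The indicator function of the `n × n` matrices of rank `t`. -/
def rankIndicator {𝔽 : Type*} [Field 𝔽] {n : ℕ} (t : ℕ) (C : Matrix (Fin n) (Fin n) 𝔽) : 𝔽 :=
  if C.rank = t then 1 else 0

/-- The function `rank_t(F)`, `A ↦ rank_t(F(A))`. -/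
def rankFun {𝔽 : Type*} [Field 𝔽] {n m : ℕ} (t : ℕ) (F : genericAlgebra 𝔽 n m) :
    MatTuple 𝔽 n m → 𝔽 :=
  fun A => rankIndicator t (evalAt (F : Matrix (Fin n) (Fin n) (CoordRing 𝔽 n m)) A)

/-- A set `S` of functions separates the `GL_n`-orbits on a set `L` of tuples. -/
def SeparatesOrbitsOn {𝔽 : Type*} [Field 𝔽] {n m : ℕ} (S : Set (MatTuple 𝔽 n m → 𝔽))
    (L : Set (MatTuple 𝔽 n m)) : Prop :=
  ∀ A ∈ L, ∀ B ∈ L, (∀ f ∈ S, f A = f B) → glOrbit A = glOrbit B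

/-- The functions `rank_t(F)` with `0 ≤ t ≤ n` and `F` in the algebra of two generic matrices,
of degree at most `N`. -/
def rankFunsOfDegreeLE (𝔽 : Type*) [Field 𝔽] (n N : ℕ) : Set (MatTuple 𝔽 n 2 → 𝔽) :=
  {f | ∃ t ≤ n, ∃ F : genericAlgebra 𝔽 n 2, genericDegree F ≤ N ∧ f = rankFun t F}

end MatrixOrbits

end

open scoped Matrix

namespace MatrixOrbits

/-! ### Ranks of Hadamard multiples and diagonal conjugacy. -/

section Rank

variable {𝔽 : Type*} [Field 𝔽] {n : ℕ}

/-! The ranks of `A 0 - x` determine the spectrum of `A 0`, so both pairs can be conjugated to have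
the same diagonal first matrix. Lagrange polynomials in it, of degree `n - 1`, give the diagonal
matrix units. Hence every `c ∘ A 1 + diagonal δ`, with `∘` the entrywise product, is a value of a
polynomial of degree at most `2n - 1`, which lies below the stated bound
(`RankEqUpTo.hadamardRankEq`).

It remains to recover the second matrix, up to diagonal conjugation, from these ranks
(`HadamardRankEq.exists_diag`). Entries are matched one at a time. If the matched nonzero entries do
not connect `i` to `j`, rescaling one side of the cut fixes entry `(i, j)`. If they do, the entry
already agrees (`HadamardRankEq.eq_of_connected`): otherwise some choice of `c` and `δ` produces two
matrices, one with zero row and column sums and one differing from it in a single entry, whose ranks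
differ (`rank_add_single_ne`). -/

theorem rank_conj (g : GL (Fin n) 𝔽) (C : Matrix (Fin n) (Fin n) 𝔽) :
    ((g : Matrix (Fin n) (Fin n) 𝔽) * C * ((g⁻¹ : GL (Fin n) 𝔽) : Matrix (Fin n) (Fin n) 𝔽)).rank
      = C.rank := by
  rw [Matrix.rank_mul_eq_left_of_isUnit_det, Matrix.rank_mul_eq_right_of_isUnit_det]
  · exact (Matrix.isUnit_iff_isUnit_det _).1 g.isUnit
  · exact (Matrix.isUnit_iff_isUnit_det _).1 (g⁻¹).isUnit

/-- Adding a nonzero multiple of a matrix unit to a matrix with vanishing row and column sums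
changes the rank. -/
theorem rank_add_single_ne (M : Matrix (Fin n) (Fin n) 𝔽) (hrow : M *ᵥ 1 = 0)
    (hcol : 1 ᵥ* M = 0) (i j : Fin n) {c : 𝔽} (hc : c ≠ 0) :
    (M + Matrix.single i j c).rank ≠ M.rank := by
  intro h
  -- Pairing with the all-ones covector kills `M` and leaves `c * v j`.
  have key : ∀ v, (M + Matrix.single i j c) *ᵥ v = 0 → v j = 0 := by
    intro v hv
    have h1 : (1 : Fin n → 𝔽) ⬝ᵥ ((M + Matrix.single i j c) *ᵥ v) = 0 := by simp [hv]
    rw [Matrix.add_mulVec, dotProduct_add, Matrix.dotProduct_mulVec, hcol, zero_dotProduct,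
      zero_add, Matrix.single_mulVec] at h1
    simpa [dotProduct, Function.update_apply, hc] using h1
  have hlt : LinearMap.ker (M + Matrix.single i j c).mulVecLin < LinearMap.ker M.mulVecLin := by
    refine lt_of_le_of_ne (fun v hv => ?_) fun he => ?_
    · rw [LinearMap.mem_ker, Matrix.mulVecLin_apply] at hv ⊢
      have hj := key v hv
      rw [Matrix.add_mulVec, Matrix.single_mulVec, hj] at hv
      simpa using hv
    -- The all-ones vector makes the inclusion of kernels strict.
    · have h1 : (1 : Fin n → 𝔽) ∈ LinearMap.ker M.mulVecLin := by simpa using hrow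
      rw [← he, LinearMap.mem_ker, Matrix.mulVecLin_apply] at h1
      simpa using key _ h1
  have h2 := Submodule.finrank_lt_finrank_of_lt hlt
  have h3 := LinearMap.finrank_range_add_finrank_ker M.mulVecLin
  have h4 := LinearMap.finrank_range_add_finrank_ker (M + Matrix.single i j c).mulVecLin
  unfold Matrix.rank at h
  omega

/-- Hadamard multiples of `a` and `b`, shifted by the same diagonal matrix, have equal ranks. -/
def HadamardRankEq (a b : Matrix (Fin n) (Fin n) 𝔽) : Prop :=
  ∀ (c : Matrix (Fin n) (Fin n) 𝔽) (δ : Fin n → 𝔽),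
    (Matrix.of (fun i j => c i j * a i j) + Matrix.diagonal δ).rank =
      (Matrix.of (fun i j => c i j * b i j) + Matrix.diagonal δ).rank

/-- For indices connected by `r` there is a matrix supported on `r` and the diagonal
with a single nonzero row sum and a single nonzero column sum. -/
theorem exists_flow (r : Fin n → Fin n → Prop) {i j : Fin n} (h : Relation.EqvGen r i j) :
    ∃ N : Matrix (Fin n) (Fin n) 𝔽, (∀ p q, N p q ≠ 0 → p = q ∨ r p q) ∧
      N *ᵥ 1 = Pi.single i 1 ∧ 1 ᵥ* N = Pi.single j 1 := by
  have hs : ∀ p q : Fin n, (Matrix.single p q (1 : 𝔽)) *ᵥ 1 = Pi.single p 1 := fun p q => by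
    rw [Matrix.single_mulVec]; simp [Pi.single]
  have hs' : ∀ p q : Fin n, 1 ᵥ* (Matrix.single p q (1 : 𝔽)) = Pi.single q 1 := fun p q => by
    rw [← Matrix.mulVec_transpose, Matrix.transpose_single, hs]
  have key : ∀ x y, Relation.EqvGen r x y → ∃ N : Matrix (Fin n) (Fin n) 𝔽,
      (∀ p q, N p q ≠ 0 → p = q ∨ r p q) ∧
      N *ᵥ 1 = 0 ∧ 1 ᵥ* N = Pi.single y 1 - Pi.single x 1 := by
    intro x y hxy
    induction hxy with
    | rel x y hxy =>
      -- The free diagonal entry cancels the row sum. Negating this matrix traverses the edge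
      -- backwards, so directed support suffices for undirected connectivity.
      refine ⟨Matrix.single x y 1 - Matrix.single x x 1, ?_, ?_, ?_⟩
      · intro p q hpq
        by_contra! hne
        apply hpq
        have h1 : ¬ (x = p ∧ y = q) := by rintro ⟨rfl, rfl⟩; exact hne.2 hxy
        have h2 : ¬ (x = p ∧ x = q) := by rintro ⟨rfl, rfl⟩; exact hne.1 rfl
        simp [h1, h2]
      · rw [Matrix.sub_mulVec, hs, hs, sub_self]
      · rw [Matrix.vecMul_sub, hs', hs']
    | refl x => exact ⟨0, by simp, by simp, by simp⟩
    | symm x y _ ih =>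
      obtain ⟨N, h1, h2, h3⟩ := ih
      refine ⟨-N, fun p q hpq => h1 p q (by simpa using hpq), ?_, ?_⟩
      · rw [Matrix.neg_mulVec, h2, neg_zero]
      · rw [Matrix.vecMul_neg, h3, neg_sub]
    | trans x y z _ _ ih ih' =>
      obtain ⟨N, h1, h2, h3⟩ := ih
      obtain ⟨N', h1', h2', h3'⟩ := ih'
      refine ⟨N + N', fun p q hpq => ?_, ?_, ?_⟩
      · by_cases h0 : N p q = 0
        · exact h1' p q (by simpa [h0] using hpq)
        · exact h1 p q h0
      · rw [Matrix.add_mulVec, h2, h2', add_zero]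
      · rw [Matrix.vecMul_add, h3, h3']; abel
  obtain ⟨N, h1, h2, h3⟩ := key i j h
  refine ⟨N + Matrix.single i i 1, fun p q hpq => ?_, ?_, ?_⟩
  · by_cases h0 : N p q = 0
    · left
      by_contra hne
      have h2 : ¬ (i = p ∧ i = q) := by rintro ⟨rfl, rfl⟩; exact hne rfl
      simp [h0, h2] at hpq
    · exact h1 p q h0
  · rw [Matrix.add_mulVec, h2, hs, zero_add]
  · rw [Matrix.vecMul_add, h3, hs']; abel

theorem HadamardRankEq.eq_zero_iff {a b : Matrix (Fin n) (Fin n) 𝔽} (h : HadamardRankEq a b)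
    (i j : Fin n) : a i j = 0 ↔ b i j = 0 := by
  have key : ∀ a : Matrix (Fin n) (Fin n) 𝔽,
      (Matrix.of (fun p q => Matrix.single i j (1 : 𝔽) p q * a p q) + Matrix.diagonal 0)
        = Matrix.single i j (a i j) := by
    intro a
    ext p q
    by_cases hpq : i = p ∧ j = q
    · obtain ⟨rfl, rfl⟩ := hpq; simp
    · simp [Matrix.single_apply, hpq]
  have h1 := h (Matrix.single i j 1) 0
  rw [key, key] at h1
  have h0 : ∀ x : 𝔽, x = 0 ↔ (Matrix.single i j x).rank = 0 := by
    intro x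
    refine ⟨fun hx => by simp [hx], fun hx => by_contra fun hne => ?_⟩
    apply rank_add_single_ne 0 (by simp) (by simp) i j hne
    simpa using hx
  rw [h0, h0, h1]

/-- The flow `N` uses only entries where `a` and `b` agree, so `c` and `δ` can realize `single i j 1
- N`, with zero row and column sums, from `a`; from `b` they give the same matrix except possibly at
`(i, j)`. -/
theorem HadamardRankEq.eq_of_connected {a b : Matrix (Fin n) (Fin n) 𝔽} (h : HadamardRankEq a b)
    {r : Fin n → Fin n → Prop} (hr : ∀ p q, r p q → a p q ≠ 0 ∧ b p q = a p q) {i j : Fin n}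
    (hij : Relation.EqvGen r i j) : b i j = a i j := by
  classical
  by_cases ha : a i j = 0
  · rw [ha, (h.eq_zero_iff i j).1 ha]
  obtain ⟨N, hN, hrow, hcol⟩ := exists_flow (𝔽 := 𝔽) r hij
  by_contra hne
  -- The diagonal of `N` is left to `δ`, since `a` may vanish there.
  set c : Matrix (Fin n) (Fin n) 𝔽 := Matrix.of fun p q =>
    Matrix.single i j (a i j)⁻¹ p q - if p = q then 0 else N p q * (a p q)⁻¹ with hc
  have hA : Matrix.of (fun p q => c p q * a p q) + Matrix.diagonal (fun p => - N p p)
      = Matrix.single i j 1 - N := by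
    ext p q
    simp only [hc, Matrix.of_apply, Matrix.add_apply, Matrix.sub_apply, Matrix.diagonal_apply,
      Matrix.single_apply]
    by_cases hpq : p = q
    · subst hpq
      by_cases hi : i = p ∧ j = p
      · obtain ⟨rfl, rfl⟩ := hi
        simp [ha, sub_eq_add_neg]
      · simp [hi]
    · by_cases h0 : N p q = 0
      · by_cases hi : i = p ∧ j = q
        · obtain ⟨rfl, rfl⟩ := hi
          simp [ha, hpq, h0]
        · simp [hi, hpq, h0]
      · have h1 := hr p q ((hN p q h0).resolve_left hpq)
        by_cases hi : i = p ∧ j = q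
        · obtain ⟨rfl, rfl⟩ := hi
          simp [hpq, sub_mul, h1.1]
        · simp [hpq, hi, h1.1]
  have hB : Matrix.of (fun p q => c p q * b p q) + Matrix.diagonal (fun p => - N p p)
      = (Matrix.single i j 1 - N) + Matrix.single i j ((a i j)⁻¹ * b i j - 1) := by
    rw [← hA]
    ext p q
    simp only [hc, Matrix.of_apply, Matrix.add_apply, Matrix.diagonal_apply,
      Matrix.single_apply]
    by_cases hpq : p = q
    · subst hpq
      by_cases hi : i = p ∧ j = p
      · obtain ⟨rfl, rfl⟩ := hi
        simp [ha]
        ring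
      · simp [hi]
    · by_cases h0 : N p q = 0
      · by_cases hi : i = p ∧ j = q
        · obtain ⟨rfl, rfl⟩ := hi
          simp [ha, hpq, h0]
        · simp [hi, hpq, h0]
      · have h1 := hr p q ((hN p q h0).resolve_left hpq)
        by_cases hi : i = p ∧ j = q
        · obtain ⟨rfl, rfl⟩ := hi
          exact absurd h1.2 hne
        · simp [hpq, hi, h1.2]
  have h1 := h c (fun p => - N p p)
  rw [hA, hB] at h1
  refine rank_add_single_ne (Matrix.single i j 1 - N) ?_ ?_ i j ?_ h1.symm
  · rw [Matrix.sub_mulVec, hrow, Matrix.single_mulVec]; simp [Pi.single]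
  · rw [Matrix.vecMul_sub, hcol, ← Matrix.mulVec_transpose, Matrix.transpose_single,
      Matrix.single_mulVec]
    simp [Pi.single]
  · rw [sub_ne_zero]
    intro h2
    apply hne
    field_simp at h2
    exact h2

/-- The conjugate of a matrix by an invertible diagonal matrix. -/
def diagConj (d : Fin n → 𝔽ˣ) (b : Matrix (Fin n) (Fin n) 𝔽) : Matrix (Fin n) (Fin n) 𝔽 :=
  Matrix.of fun i j => ((d i)⁻¹ : 𝔽ˣ) * b i j * d j

/-- The invertible diagonal matrix with diagonal `d`. -/
def diagGL (d : Fin n → 𝔽ˣ) : GL (Fin n) 𝔽 where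
  val := Matrix.diagonal fun i => (d i : 𝔽)
  inv := Matrix.diagonal fun i => ((d i)⁻¹ : 𝔽ˣ)
  val_inv := by simp
  inv_val := by simp

theorem HadamardRankEq.diagConj {a b : Matrix (Fin n) (Fin n) 𝔽} (h : HadamardRankEq a b)
    (d : Fin n → 𝔽ˣ) : HadamardRankEq a (diagConj d b) := by
  intro c δ
  rw [h c δ, ← rank_conj (diagGL d)⁻¹]
  congr 1
  ext i j
  simp only [diagGL, Units.inv_mk, MatrixOrbits.diagConj, Matrix.diagonal_mul,
    Matrix.mul_diagonal, Matrix.add_apply, Matrix.of_apply, Matrix.diagonal_apply]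
  by_cases hij : i = j
  · subst hij
    simp only [if_true]
    have : (((d i)⁻¹ : 𝔽ˣ) : 𝔽) * d i = 1 := by simp
    linear_combination δ i * this
  · simp only [hij, if_false]
    ring

theorem HadamardRankEq.exists_diag {a b : Matrix (Fin n) (Fin n) 𝔽} (h : HadamardRankEq a b) :
    ∃ d : Fin n → 𝔽ˣ, MatrixOrbits.diagConj d b = a := by
  classical
  suffices H : ∀ T : Finset (Fin n × Fin n), ∃ d : Fin n → 𝔽ˣ,
      ∀ p ∈ T, MatrixOrbits.diagConj d b p.1 p.2 = a p.1 p.2 by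
    obtain ⟨d, hd⟩ := H Finset.univ
    exact ⟨d, by ext i j; exact hd (i, j) (Finset.mem_univ _)⟩
  intro T
  induction T using Finset.induction_on with
  | empty => exact ⟨1, by simp⟩
  | insert e T _ ih =>
    obtain ⟨d, hd⟩ := ih
    obtain ⟨i, j⟩ := e
    have hab := h.diagConj d
    let r : Fin n → Fin n → Prop := fun p q => (p, q) ∈ T ∧ a p q ≠ 0
    by_cases hij : Relation.EqvGen r i j
    · refine ⟨d, fun p hp => ?_⟩
      rcases Finset.mem_insert.1 hp with rfl | hp
      · exact hab.eq_of_connected (r := r) (fun p q hpq => ⟨hpq.2, hd _ hpq.1⟩) hij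
      · exact hd p hp
    · by_cases ha : a i j = 0
      · refine ⟨d, fun p hp => ?_⟩
        rcases Finset.mem_insert.1 hp with rfl | hp
        · rw [ha, (hab.eq_zero_iff i j).1 ha]
        · exact hd p hp
      · set b' := MatrixOrbits.diagConj d b with hb'
        have hb : b' i j ≠ 0 := fun h0 => ha ((hab.eq_zero_iff i j).2 h0)
        let u : 𝔽ˣ := Units.mk0 (a i j / b' i j) (div_ne_zero ha hb)
        -- Constant on components, so matched nonzero entries are preserved, while entry `(i, j)` is
        -- multiplied by `u`.
        let s : Fin n → 𝔽ˣ := fun p => if Relation.EqvGen r i p then 1 else u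
        refine ⟨fun p => d p * s p, fun p hp => ?_⟩
        have hmul : ∀ p q, MatrixOrbits.diagConj (fun p => d p * s p) b p q
            = ((s p)⁻¹ : 𝔽ˣ) * b' p q * s q := by
          intro p q
          simp only [hb', MatrixOrbits.diagConj, Matrix.of_apply, mul_inv, Units.val_mul]
          ring
        rw [hmul]
        rcases Finset.mem_insert.1 hp with rfl | hp
        · have h1 : s i = 1 := if_pos (Relation.EqvGen.refl i)
          have h2 : s j = u := if_neg hij
          simp only [h1, h2, u, Units.val_mk0]
          field_simp
          simp
        · obtain ⟨p, q⟩ := p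
          by_cases hpq : a p q = 0
          · simp [hpq, (hab.eq_zero_iff p q).1 hpq]
          · have hrpq : r p q := ⟨hp, hpq⟩
            have hs : s p = s q := by
              have : Relation.EqvGen r i p ↔ Relation.EqvGen r i q :=
                ⟨fun h => h.trans _ _ _ (.rel _ _ hrpq),
                  fun h => h.trans _ _ _ (.symm _ _ (.rel _ _ hrpq))⟩
              simp only [s, this]
            rw [← hd _ hp, hs, mul_right_comm]
            simp

end Rank

/-! ### Degree bounds in the free algebra. -/

section Degree

variable {𝔽 : Type*} [Field 𝔽] {m : ℕ}

theorem ncDegree_le_iff {f : FreeAlgebra 𝔽 (Fin m)} {d : ℕ} : ncDegree f ≤ d ↔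
    ∀ w ∈ (FreeAlgebra.equivMonoidAlgebraFreeMonoid f :
      MonoidAlgebra 𝔽 (FreeMonoid (Fin m))).coeff.support, w.length ≤ d := by
  rw [ncDegree, Finset.sup_le_iff]

theorem ncDegree_add_le {f g : FreeAlgebra 𝔽 (Fin m)} {d : ℕ} (hf : ncDegree f ≤ d)
    (hg : ncDegree g ≤ d) : ncDegree (f + g) ≤ d := by
  classical
  rw [ncDegree_le_iff] at *
  intro w hw
  rw [map_add] at hw
  rcases Finset.mem_union.1 (Finsupp.support_add hw) with h | h
  exacts [hf w h, hg w h]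

theorem ncDegree_smul_le (c : 𝔽) {f : FreeAlgebra 𝔽 (Fin m)} {d : ℕ} (hf : ncDegree f ≤ d) :
    ncDegree (c • f) ≤ d := by
  rw [ncDegree_le_iff] at *
  intro w hw
  rw [map_smul] at hw
  exact hf w (Finsupp.support_smul hw)

theorem ncDegree_zero : ncDegree (0 : FreeAlgebra 𝔽 (Fin m)) = 0 := by
  simp [ncDegree]

theorem ncDegree_sum_le {ι : Type*} (s : Finset ι) {f : ι → FreeAlgebra 𝔽 (Fin m)} {d : ℕ}
    (hf : ∀ i ∈ s, ncDegree (f i) ≤ d) : ncDegree (∑ i ∈ s, f i) ≤ d :=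
  Finset.sum_induction _ (fun f => ncDegree f ≤ d) (fun _ _ => ncDegree_add_le)
    (by simp [ncDegree_zero]) hf

theorem ncDegree_mul_le {f g : FreeAlgebra 𝔽 (Fin m)} {d e : ℕ} (hf : ncDegree f ≤ d)
    (hg : ncDegree g ≤ e) : ncDegree (f * g) ≤ d + e := by
  classical
  rw [ncDegree_le_iff] at *
  intro w hw
  rw [map_mul] at hw
  obtain ⟨u, hu, v, hv, rfl⟩ := Finset.mem_mul.1 (MonoidAlgebra.support_coeff_mul_subset _ _ hw)
  rw [FreeMonoid.length_mul]
  exact add_le_add (hf u hu) (hg v hv)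

theorem ncDegree_ι_le (k : Fin m) : ncDegree (FreeAlgebra.ι 𝔽 k) ≤ 1 := by
  rw [ncDegree_le_iff]
  intro w hw
  simp [FreeAlgebra.equivMonoidAlgebraFreeMonoid] at hw
  simp [hw]

theorem ncDegree_one : ncDegree (1 : FreeAlgebra 𝔽 (Fin m)) = 0 := by
  rw [← Nat.le_zero, ncDegree_le_iff]
  intro w hw
  rw [map_one] at hw
  simp [MonoidAlgebra.one_def] at hw
  simp [hw]

theorem ncDegree_pow_le {f : FreeAlgebra 𝔽 (Fin m)} {d : ℕ} (hf : ncDegree f ≤ d) (k : ℕ) :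
    ncDegree (f ^ k) ≤ k * d := by
  induction k with
  | zero => simp [ncDegree_one]
  | succ k ih => rw [pow_succ, add_mul, one_mul]; exact ncDegree_mul_le ih hf

theorem ncDegree_aeval_ι_le (k : Fin m) (p : Polynomial 𝔽) :
    ncDegree (Polynomial.aeval (FreeAlgebra.ι 𝔽 k) p) ≤ p.natDegree := by
  rw [Polynomial.aeval_eq_sum_range]
  refine ncDegree_sum_le _ fun i hi => ncDegree_smul_le _ ?_
  have := ncDegree_pow_le (ncDegree_ι_le (𝔽 := 𝔽) k) i
  have := Finset.mem_range.1 hi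
  omega

end Degree

/-! ### From rank functions to orbits. -/

section Orbits

variable {𝔽 : Type*} [Field 𝔽] {n m : ℕ}

theorem simConj_mul (g h : GL (Fin n) 𝔽) (A : MatTuple 𝔽 n m) :
    simConj (g * h) A = simConj g (simConj h A) := by
  funext k
  simp only [simConj, _root_.mul_inv_rev, Units.val_mul, mul_assoc]

theorem glOrbit_simConj (g : GL (Fin n) 𝔽) (A : MatTuple 𝔽 n m) :
    glOrbit (simConj g A) = glOrbit A := by
  ext C
  constructor
  · rintro ⟨h, rfl⟩
    exact ⟨h * g, simConj_mul h g A⟩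
  · rintro ⟨h, rfl⟩
    exact ⟨h * g⁻¹, by simp [← simConj_mul]⟩

theorem lift_simConj (g : GL (Fin n) 𝔽) (A : MatTuple 𝔽 n m) (f : FreeAlgebra 𝔽 (Fin m)) :
    FreeAlgebra.lift 𝔽 (simConj g A) f = (g : Matrix (Fin n) (Fin n) 𝔽) *
      FreeAlgebra.lift 𝔽 A f * ((g⁻¹ : GL (Fin n) 𝔽) : Matrix (Fin n) (Fin n) 𝔽) := by
  induction f using FreeAlgebra.induction with
  | grade0 r =>
    rw [AlgHom.commutes, AlgHom.commutes, ← Algebra.commutes, mul_assoc, Units.mul_inv, mul_one]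
  | grade1 k => simp [simConj]
  | add a b ha hb => rw [map_add, map_add, ha, hb, mul_add, add_mul]
  | mul a b ha hb =>
    rw [map_mul, map_mul, ha, hb]
    simp only [mul_assoc]
    rw [Units.inv_mul_cancel_left]

theorem evalAt_lift (A : MatTuple 𝔽 n m) (f : FreeAlgebra 𝔽 (Fin m)) :
    evalAt (FreeAlgebra.lift 𝔽 (genericMatrix 𝔽 n m) f) A = FreeAlgebra.lift 𝔽 A f := by
  have h : ((MvPolynomial.aeval (R := 𝔽) fun v : Fin m × Fin n × Fin n =>
      A v.1 v.2.1 v.2.2).mapMatrix).comp (FreeAlgebra.lift 𝔽 (genericMatrix 𝔽 n m))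
      = FreeAlgebra.lift 𝔽 A := by
    ext k i j
    simp [genericMatrix]
  rw [← h]
  rfl

theorem lift_genericMatrix_mem (f : FreeAlgebra 𝔽 (Fin m)) :
    FreeAlgebra.lift 𝔽 (genericMatrix 𝔽 n m) f ∈ genericAlgebra 𝔽 n m := by
  unfold genericAlgebra
  rw [Algebra.adjoin_range_eq_range_freeAlgebra_lift]
  exact ⟨f, rfl⟩

theorem exists_lift_eq (F : genericAlgebra 𝔽 n m) :
    ∃ f, FreeAlgebra.lift 𝔽 (genericMatrix 𝔽 n m) f = F := by
  exact (Algebra.adjoin_range_eq_range_freeAlgebra_lift 𝔽 _ (genericMatrix 𝔽 n m)).le F.2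

theorem rankFun_mem_abstractInvariants (t : ℕ) (F : genericAlgebra 𝔽 n m) :
    rankFun t F ∈ abstractInvariants 𝔽 n m := by
  intro g A
  obtain ⟨f, hf⟩ := exists_lift_eq F
  simp only [rankFun, rankIndicator, ← hf, evalAt_lift, lift_simConj, rank_conj]

theorem width_rankFun (t : ℕ) (F : genericAlgebra 𝔽 n m) :
    width ⟨rankFun t F, rankFun_mem_abstractInvariants t F⟩ = 1 := by
  refine IsLeast.csInf_eq ⟨⟨one_pos, fun C => rankIndicator t (C 0), ?_, fun _ => F, rfl⟩,
    fun d hd => hd.1⟩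
  intro g C
  simp only [rankIndicator, simConj, rank_conj]

/-- The matrices `f(A)` and `f(B)` have equal ranks for all `f` of degree at most `N`. -/
def RankEqUpTo (N : ℕ) (A B : MatTuple 𝔽 n m) : Prop :=
  ∀ f : FreeAlgebra 𝔽 (Fin m), ncDegree f ≤ N →
    (FreeAlgebra.lift 𝔽 A f).rank = (FreeAlgebra.lift 𝔽 B f).rank

theorem rankEqUpTo_of_rankFuns {N : ℕ} {A B : MatTuple 𝔽 n 2}
    (h : ∀ f ∈ rankFunsOfDegreeLE 𝔽 n N, f A = f B) : RankEqUpTo N A B := by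
  intro f hf
  let F : genericAlgebra 𝔽 n 2 := ⟨_, lift_genericMatrix_mem f⟩
  have hF : genericDegree F ≤ N := le_trans (Nat.sInf_le ⟨f, rfl, rfl⟩) hf
  -- With `t` the rank at `A`, the indicator is `1` at `A`, hence also at `B`.
  have h1 := h _ ⟨(FreeAlgebra.lift 𝔽 A f).rank, Matrix.rank_le_width _, F, hF, rfl⟩
  simp only [rankFun, rankIndicator, F, evalAt_lift, if_true] at h1
  by_contra hne
  rw [if_neg (Ne.symm hne)] at h1
  exact one_ne_zero h1

theorem RankEqUpTo.simConj {N : ℕ} {A B : MatTuple 𝔽 n m} (h : RankEqUpTo N A B)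
    (g g' : GL (Fin n) 𝔽) : RankEqUpTo N (simConj g A) (simConj g' B) := by
  intro f hf
  rw [lift_simConj, lift_simConj, rank_conj, rank_conj, h f hf]

theorem mem_spectrum_iff_rank_ne (C : Matrix (Fin n) (Fin n) 𝔽) (x : 𝔽) :
    x ∈ spectrum 𝔽 C ↔ (C - algebraMap 𝔽 _ x).rank ≠ n := by
  rw [spectrum.mem_iff, not_iff_not, IsUnit.sub_iff]
  constructor
  · intro h
    simpa using Matrix.rank_of_isUnit _ h
  · intro h
    rw [← Matrix.linearIndependent_cols_iff_isUnit, linearIndependent_iff_card_eq_finrank_span,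
      Set.finrank, ← Matrix.rank_eq_finrank_span_cols, h, Fintype.card_fin]

theorem RankEqUpTo.spectrum_eq {N : ℕ} (hN : 1 ≤ N) {A B : MatTuple 𝔽 n m}
    (h : RankEqUpTo N A B) (k : Fin m) : spectrum 𝔽 (A k) = spectrum 𝔽 (B k) := by
  ext x
  rw [mem_spectrum_iff_rank_ne, mem_spectrum_iff_rank_ne]
  have hd : ncDegree (FreeAlgebra.ι 𝔽 k + (-x) • (1 : FreeAlgebra 𝔽 (Fin m))) ≤ N :=
    (ncDegree_add_le (ncDegree_ι_le k) (ncDegree_smul_le _ (by simp [ncDegree_one]))).trans hN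
  have h1 := h _ hd
  simp only [neg_smul, ← sub_eq_add_neg, map_sub, map_smul, map_one,
    FreeAlgebra.lift_ι_apply] at h1
  rw [Algebra.algebraMap_eq_smul_one, h1]

theorem exists_diagonalization (C : Matrix (Fin n) (Fin n) 𝔽) {l : Fin n → 𝔽}
    (hl : Function.Injective l) (hC : ∀ i, l i ∈ spectrum 𝔽 C) :
    ∃ g : GL (Fin n) 𝔽, (g : Matrix (Fin n) (Fin n) 𝔽) * C *
      ((g⁻¹ : GL (Fin n) 𝔽) : Matrix (Fin n) (Fin n) 𝔽) = Matrix.diagonal l := by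
  have hev : ∀ i, ∃ v, Module.End.HasEigenvector (Matrix.toLin' C) (l i) v := by
    intro i
    have h1 := hC i
    rw [← Matrix.spectrum_toLin', ← Module.End.hasEigenvalue_iff_mem_spectrum] at h1
    exact h1.exists_hasEigenvector
  choose v hv using hev
  have hli := Module.End.eigenvectors_linearIndependent' (Matrix.toLin' C) l hl v hv
  have hu : IsUnit (Matrix.of v)ᵀ := by
    rw [← Matrix.linearIndependent_cols_iff_isUnit]
    exact hli
  obtain ⟨P, hP⟩ := hu
  have hCP : C * (P : Matrix (Fin n) (Fin n) 𝔽) = P * Matrix.diagonal l := by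
    ext i j
    have h1 := congrFun (hv j).apply_eq_smul i
    rw [Matrix.toLin'_apply] at h1
    rw [hP, Matrix.mul_diagonal]
    simp only [Matrix.transpose_apply, Matrix.of_apply]
    rw [mul_comm]
    exact h1
  refine ⟨P⁻¹, ?_⟩
  rw [inv_inv, mul_assoc, hCP, Units.inv_mul_cancel_left]

theorem aeval_diagonal (l : Fin n → 𝔽) (p : Polynomial 𝔽) :
    Polynomial.aeval (Matrix.diagonal l) p = Matrix.diagonal fun i => p.eval (l i) := by
  have h := Polynomial.aeval_algHom_apply (Matrix.diagonalAlgHom (n := Fin n) (α := 𝔽) 𝔽) l p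
  rw [Matrix.diagonalAlgHom_apply, Matrix.diagonalAlgHom_apply] at h
  rw [h]
  congr 1
  funext i
  rw [← Polynomial.coe_aeval_eq_eval]
  exact (Polynomial.aeval_algHom_apply (Pi.evalAlgHom 𝔽 (fun _ : Fin n => 𝔽) i) l p).symm

theorem RankEqUpTo.hadamardRankEq {N : ℕ} (hN : 2 * n - 1 ≤ N) {A B : MatTuple 𝔽 n 2}
    (h : RankEqUpTo N A B) {l : Fin n → 𝔽} (hl : Function.Injective l)
    (hA : A 0 = Matrix.diagonal l) (hB : B 0 = Matrix.diagonal l) :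
    HadamardRankEq (A 1) (B 1) := by
  intro c δ
  let P : Fin n → FreeAlgebra 𝔽 (Fin 2) := fun i =>
    Polynomial.aeval (FreeAlgebra.ι 𝔽 0) (Lagrange.basis Finset.univ l i)
  have hdeg : ∀ i, ncDegree (P i) ≤ n - 1 := fun i =>
    (ncDegree_aeval_ι_le 0 _).trans (by
      rw [Lagrange.natDegree_basis (hl.injOn) (Finset.mem_univ i), Finset.card_univ,
        Fintype.card_fin])
  have hval : ∀ C : MatTuple 𝔽 n 2, C 0 = Matrix.diagonal l → ∀ i,
      FreeAlgebra.lift 𝔽 C (P i) = Matrix.diagonal (Pi.single i 1) := by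
    intro C hC i
    rw [← Polynomial.aeval_algHom_apply, FreeAlgebra.lift_ι_apply, hC, aeval_diagonal]
    congr 1
    funext j
    by_cases hij : i = j
    · subst hij
      rw [Lagrange.eval_basis_self hl.injOn (Finset.mem_univ i), Pi.single_eq_same]
    · rw [Lagrange.eval_basis_of_ne hij (Finset.mem_univ j), Pi.single_eq_of_ne (Ne.symm hij)]
  -- `P i * X * P j` isolates entry `(i, j)` of the second matrix, in degree `(n - 1) + 1 + (n -
  -- 1)`.
  let f : FreeAlgebra 𝔽 (Fin 2) :=
    ∑ i, ∑ j, c i j • (P i * FreeAlgebra.ι 𝔽 1 * P j) + ∑ i, δ i • P i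
  have hf : ncDegree f ≤ N := by
    refine ncDegree_add_le (ncDegree_sum_le _ fun i _ => ncDegree_sum_le _ fun j _ =>
      ncDegree_smul_le _ ?_) (ncDegree_sum_le _ fun i _ => ncDegree_smul_le _ ?_)
    · have := ncDegree_mul_le (ncDegree_mul_le (hdeg i) (ncDegree_ι_le (𝔽 := 𝔽) (1 : Fin 2)))
        (hdeg j)
      have := i.pos
      omega
    · have := hdeg i
      omega
  have hfval : ∀ C : MatTuple 𝔽 n 2, C 0 = Matrix.diagonal l →
      FreeAlgebra.lift 𝔽 C f
        = Matrix.of (fun i j => c i j * C 1 i j) + Matrix.diagonal δ := by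
    intro C hC
    simp only [f, map_add, map_sum, map_smul, map_mul, hval C hC, FreeAlgebra.lift_ι_apply]
    congr 1
    · ext p q
      simp [Matrix.sum_apply, Matrix.diagonal_mul, Matrix.mul_diagonal, Pi.single_apply]
    · ext p q
      simp [Matrix.sum_apply, Matrix.diagonal_apply, Pi.single_apply]
  rw [← hfval A hA, ← hfval B hB]
  exact h f hf

theorem exists_injective_range_eq {α : Type*} {s : Set α} {n : ℕ} (hs : s.encard = n) :
    ∃ l : Fin n → α, Function.Injective l ∧ Set.range l = s := by
  have hfin : s.Finite := Set.finite_of_encard_eq_coe hs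
  have := hfin.to_subtype
  have hcard : Nat.card s = n := by
    rw [Nat.card_coe_set_eq, Set.ncard, hs, ENat.toNat_natCast]
  let e := Finite.equivFinOfCardEq hcard
  exact ⟨fun i => (e.symm i : α), Subtype.val_injective.comp e.symm.injective, by
    ext x
    constructor
    · rintro ⟨i, rfl⟩; exact (e.symm i).2
    · intro hx; exact ⟨e ⟨x, hx⟩, by simp⟩⟩

theorem glOrbit_eq_of_rankEqUpTo {N : ℕ} (hn : 1 ≤ n) (hN : 2 * n - 1 ≤ N)
    {A B : MatTuple 𝔽 n 2} (hA : A ∈ simpleSpectrumPairs 𝔽 n) (h : RankEqUpTo N A B) :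
    glOrbit A = glOrbit B := by
  obtain ⟨l, hl, hrange⟩ := exists_injective_range_eq hA
  have hspec := h.spectrum_eq (by omega) 0
  obtain ⟨g, hg⟩ := exists_diagonalization (A 0) hl fun i => hrange ▸ ⟨i, rfl⟩
  obtain ⟨g', hg'⟩ := exists_diagonalization (B 0) hl fun i => hspec ▸ hrange ▸ ⟨i, rfl⟩
  obtain ⟨d, hd⟩ :=
    ((h.simConj g g').hadamardRankEq hN hl hg hg').exists_diag
  rw [← glOrbit_simConj g A, ← glOrbit_simConj g' B,
    ← glOrbit_simConj (diagGL d)⁻¹ (MatrixOrbits.simConj g' B)]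
  congr 1
  funext k
  fin_cases k
  · change MatrixOrbits.simConj g A 0 = ((diagGL d)⁻¹ : GL (Fin n) 𝔽).val *
      MatrixOrbits.simConj g' B 0 * (((diagGL d)⁻¹)⁻¹ : GL (Fin n) 𝔽).val
    rw [show MatrixOrbits.simConj g A 0 = _ from hg,
      show MatrixOrbits.simConj g' B 0 = _ from hg', inv_inv]
    ext i j
    by_cases hij : i = j
    · subst hij
      simp only [diagGL, Units.inv_mk, Matrix.mul_diagonal, Matrix.diagonal_apply_eq]
      rw [mul_right_comm, Units.inv_mul, one_mul]
    · simp [diagGL, Units.inv_mk, hij]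
  · change MatrixOrbits.simConj g A 1 = ((diagGL d)⁻¹ : GL (Fin n) 𝔽).val *
      MatrixOrbits.simConj g' B 1 * (((diagGL d)⁻¹)⁻¹ : GL (Fin n) 𝔽).val
    rw [← hd, inv_inv]
    ext i j
    simp [diagGL, diagConj, Units.inv_mk]

end Orbits

end MatrixOrbits

theorem mainTheorem2 {𝔽 : Type*} [Field 𝔽] (n : ℕ) (hn : 1 ≤ n) :
    (∀ f ∈ MatrixOrbits.rankFunsOfDegreeLE 𝔽 n ((n + 1) * (2 * n - 1)),
      ∃ hf : f ∈ MatrixOrbits.abstractInvariants 𝔽 n 2, MatrixOrbits.width ⟨f, hf⟩ = 1) ∧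
    MatrixOrbits.SeparatesOrbitsOn
      (MatrixOrbits.rankFunsOfDegreeLE 𝔽 n ((n + 1) * (2 * n - 1)))
      (MatrixOrbits.simpleSpectrumPairs 𝔽 n) := by
  constructor
  · rintro _ ⟨t, _, F, _, rfl⟩
    exact ⟨MatrixOrbits.rankFun_mem_abstractInvariants t F, MatrixOrbits.width_rankFun t F⟩
  · intro A hA B _ h
    exact MatrixOrbits.glOrbit_eq_of_rankEqUpTo hn (Nat.le_mul_of_pos_left _ n.succ_pos) hA
      (MatrixOrbits.rankEqUpTo_of_rankFuns h)
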